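/- Let $\mathcal A$ be a finitely cocomplete homological category, that is, a category with finite limits and finite colimits which is pointed, regular and protomodular. An equivalence relation $(R,r_1,r_2)$ on $X$ is *effective* if it is the kernel pair of some morphism; its *normalisation* is the monomorphism $r_2\circ\ker(r_1)\colon \mathrm{Ker}(r_1)\to X$, and an *ideal* of $X$ is a subobject which is the normalisation of some equivalence relation on $X$. Morphisms $k\colon K\to X$ and $l\colon L\to X$ *(Huq-)commute* if there is $\varphi\colon K\times L\to X$ with $\varphi\circ\langle 1_K,0\rangle=k$ and $\varphi\circ\langle 0,1_L\rangle=l$. Equivalence relations $(R,r_1,r_2)$ and $(S,s_1,s_2)$ on $X$ with reflexivity morphisms $\Delta_R$, $\Delta_S$ *(Smith-)commute* if there is $\theta\colon R\times_X S\to X$, defined on the pullback of $r_1$ and $s_2$, with $\theta\circ\langle 1_R,\Delta_S\circ r_1\rangle=r_2$ and $\theta\circ\langle\Delta_R\circ s_2,1_S\rangle=s_1$. The *Smith is Huq* condition says that any two effective equivalence relations on a given object Smith-commute as soon as their normalisations Huq-commute. For $k\colon K\to X$ and $l\colon L\to X$, the *Huq commutator* $[K,L]^{\mathrm{Huq}}\leq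 X$ is the kernel of $X\to Q$, where $Q$ is the colimit of the diagram formed by $k$, $l$, $\langle 1_K,0\rangle\colon K\to K\times L$ and $\langle 0,1_L\rangle\colon L\to K\times L$. For subobjects $K$, $L$, $M$ of $X$, the *ternary commutator* $[K,L,M]\leq X$ is the image of the composite $K\otimes L\otimes M\to K+L+M\to X$, where $K\otimes L\otimes M$ is the kernel of the canonical morphism $K+L+M\to (K+L)\times(K+M)\times(L+M)$ (whose components send $M$, $L$ and $K$, respectively, to zero and preserve the other summands), and $K+L+M\to X$ is induced by the inclusions. Then the following are equivalent: 1. $\mathcal A$ satisfies the Smith is Huq condition; 2. any two effective equivalence relations on a given object Smith-commute as soon as their normalisations Huq-commute; 3. any two equivalence relations on a given object Smith-commute as soon as their normalisations Huq-commute; 4. for every object $X$ and all ideals $K$, $L$ of $X$ we have $[K,L,X]\leq[K,L]^{\mathrm{Huq}}$. -/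

import Mathlib

open CategoryTheory CategoryTheory.Limits

universe v u

namespace SmithHuq

noncomputable section

/-- Protomodularity of a pointed category with finite limits: the Split Short Five Lemma.
For every morphism of points `(x, g)` from `(p, s)` to `(p', s')`, if `g` and the induced
morphism `Ker p ⟶ Ker p'` are isomorphisms, then so is `x`. Together with `Regular C` and
`HasZeroObject C` this says that `C` is a homological category. -/
class Protomodular (C : Type u) [Category.{v} C] [HasZeroMorphisms C] [HasFiniteLimits C] :
    Prop where
  split_short_five : ∀ {X G X' G' : C} (p : X ⟶ G) (s : G ⟶ X) (p' : X' ⟶ G') (s' : G' ⟶ X')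
    (_ : s ≫ p = 𝟙 G) (_ : s' ≫ p' = 𝟙 G') (x : X ⟶ X') (g : G ⟶ G')
    (w : p ≫ g = x ≫ p') (_ : s ≫ x = g ≫ s'),
    IsIso g → IsIso (kernel.map p p' x g w) → IsIso x

/-- A parallel pair is effective if it is the kernel pair of some morphism. -/
def IsEffective {C : Type u} [Category.{v} C] {R X : C} (r₁ r₂ : R ⟶ X) : Prop :=
  ∃ (Y : C) (f : X ⟶ Y), IsKernelPair f r₁ r₂

section Pointed

variable {C : Type u} [Category.{v} C] [HasZeroMorphisms C] [HasFiniteLimits C]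

/-- The normalisation of a relation `(R, r₁, r₂)` on `X`: the composite of the kernel of `r₁`
with `r₂`. -/
def normalisation {R X : C} (r₁ r₂ : R ⟶ X) : kernel r₁ ⟶ X :=
  kernel.ι r₁ ≫ r₂

/-- The normalisation of a relation is a monomorphism. -/
instance normalisation_mono {R X : C} (r₁ r₂ : R ⟶ X) [JointlyMono₂ r₁ r₂] :
    Mono (normalisation r₁ r₂) where
  right_cancellation a b h := by
    rw [← cancel_mono (kernel.ι r₁)]
    refine JointlyMono₂.right_cancellation (p₁ := r₁) (p₂ := r₂) _ _ (by simp) ?_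
    simpa [normalisation] using h

/-- A (mono)morphism `k : K ⟶ X` is an ideal if it is, up to isomorphism over `X`, the
normalisation of an equivalence relation on `X`. -/
def IsIdeal {K X : C} (k : K ⟶ X) : Prop :=
  ∃ (R : C) (r₁ r₂ : R ⟶ X) (_ : EquivalenceRelation r₁ r₂) (i : K ≅ kernel r₁),
    i.hom ≫ normalisation r₁ r₂ = k

/-- Two coterminal morphisms `k`, `l` Huq-commute if there is `φ : K ⨯ L ⟶ X` which restricts to
`k` along `⟨1, 0⟩` and to `l` along `⟨0, 1⟩`. -/
def HuqCommute {K L X : C} (k : K ⟶ X) (l : L ⟶ X) : Prop :=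
  ∃ φ : K ⨯ L ⟶ X, prod.lift (𝟙 K) 0 ≫ φ = k ∧ prod.lift 0 (𝟙 L) ≫ φ = l

/-- Two equivalence relations `(R, r₁, r₂)` and `(S, s₁, s₂)` on `X` Smith-commute if there is a
connector between them: a morphism `θ` on the pullback of `r₁` and `s₂` such that
`θ ∘ ⟨1_R, Δ_S ∘ r₁⟩ = r₂` and `θ ∘ ⟨Δ_R ∘ s₂, 1_S⟩ = s₁`. Here `Δ_R = eR.r`, `Δ_S = eS.r`
are the (unique) reflexivity morphisms. -/
def SmithCommute {R S X : C} {r₁ r₂ : R ⟶ X} {s₁ s₂ : S ⟶ X}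
    (eR : EquivalenceRelation r₁ r₂) (eS : EquivalenceRelation s₁ s₂) : Prop :=
  ∃ θ : pullback r₁ s₂ ⟶ X,
    pullback.lift (𝟙 R) (r₁ ≫ eS.r) (by simp) ≫ θ = r₂ ∧
    pullback.lift (s₂ ≫ eR.r) (𝟙 S) (by simp) ≫ θ = s₁

/-- The *Smith is Huq* condition (SH): two effective equivalence relations on a given object
always (Smith-)commute as soon as their normalisations (Huq-)commute. -/
def SmithIsHuq (C : Type u) [Category.{v} C] [HasZeroMorphisms C] [HasFiniteLimits C] : Prop :=
  ∀ ⦃X R S : C⦄ ⦃r₁ r₂ : R ⟶ X⦄ ⦃s₁ s₂ : S ⟶ X⦄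
    (eR : EquivalenceRelation r₁ r₂) (eS : EquivalenceRelation s₁ s₂),
    IsEffective r₁ r₂ → IsEffective s₁ s₂ →
    HuqCommute (normalisation r₁ r₂) (normalisation s₁ s₂) → SmithCommute eR eS

end Pointed

section Commutators

variable {C : Type u} [Category.{v} C] [HasZeroMorphisms C] [HasFiniteLimits C]
  [HasFiniteColimits C]

/-- The Huq commutator of `k` and `l`, as a subobject of `X`: the kernel of `X ⟶ Q`, where `Q` is
the colimit of the diagram consisting of `k : K ⟶ X`, `l : L ⟶ X`, `⟨1, 0⟩ : K ⟶ K ⨯ L` and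
`⟨0, 1⟩ : L ⟶ K ⨯ L`. A cocone on this diagram is the same as a commutative square on the two
induced morphisms out of `K ⨿ L`, so that `Q` is their pushout. -/
def huqCommutator {K L X : C} (k : K ⟶ X) (l : L ⟶ X) : Subobject X :=
  kernelSubobject
    (pushout.inl (coprod.desc k l) (coprod.desc (prod.lift (𝟙 K) 0) (prod.lift 0 (𝟙 L))))

/-- The canonical comparison morphism `X + Y + Z ⟶ (X + Y) × (X + Z) × (Y + Z)`, whose components
kill `Z`, `Y` and `X`, respectively, and preserve the other two summands. -/
def coSmashComparison (X Y Z : C) : (X ⨿ Y) ⨿ Z ⟶ (X ⨿ Y) ⨯ ((X ⨿ Z) ⨯ (Y ⨿ Z)) :=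
  prod.lift (coprod.desc (coprod.desc coprod.inl coprod.inr) 0)
    (prod.lift (coprod.desc (coprod.desc coprod.inl 0) coprod.inr)
      (coprod.desc (coprod.desc 0 coprod.inl) coprod.inr))

/-- The ternary co-smash product `X ⊗ Y ⊗ Z`. -/
def coSmash (X Y Z : C) : C :=
  kernel (coSmashComparison X Y Z)

/-- The canonical inclusion of the co-smash product `X ⊗ Y ⊗ Z` into `X + Y + Z`. -/
def coSmashι (X Y Z : C) : coSmash X Y Z ⟶ (X ⨿ Y) ⨿ Z :=
  kernel.ι (coSmashComparison X Y Z)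

/-- The ternary commutator `[K, L, M]` of `k : K ⟶ X`, `l : L ⟶ X`, `m : M ⟶ X`, as a subobject
of `X`: the image of the composite `K ⊗ L ⊗ M ⟶ K + L + M ⟶ X`. -/
def ternaryCommutator [HasImages C] {K L M X : C} (k : K ⟶ X) (l : L ⟶ X) (m : M ⟶ X) :
    Subobject X :=
  imageSubobject (coSmashι K L M ≫ coprod.desc (coprod.desc k l) m)

end Commutators

end

end SmithHuq

/-! Both nontrivial implications compare `K + L + X` with `(K + X) ×_X (L + X)`, through the regular
epimorphism `coprodToPullback`. In the Smith condition, the rule of a connector is "`x - t + y`" for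
`x`, `y` lying over a common `t`, and it is determined by its restrictions to `K`, `L` and `X`.

From Smith is Huq to `[K, L, X] ≤ [K, L]`: let `q` be the universal quotient of `K + L + X` in which
the kernels of the projections to `L + X` and `K + X` commute. A connector on the quotient makes `q`
factor through `coprodToPullback`, so `q` kills the co-smash product (`SmithIsHuq.comp_eq_zero`).
The map to `X/[K, L]` factors through `q`, because ideals absorb these kernels.

Conversely, if `K` and `L` commute, then `[K, L]` vanishes, hence so does `[K, L, X]`. The map `K +
L + X ⟶ X` then descends to the pullback (`kernel_ι_coprodToPullback_comp`) and from there to `R ×_X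
S`, where it is a connector (`smithCommute_of_coSmashι_comp`). Effectiveness plays no role in this
direction. -/

namespace SmithHuq

attribute [local simp] prod.lift_fst prod.lift_snd prod.lift_fst_assoc prod.lift_snd_assoc
  coprod.inl_desc coprod.inr_desc coprod.inl_desc_assoc coprod.inr_desc_assoc
  pullback.lift_fst pullback.lift_snd pullback.lift_fst_assoc pullback.lift_snd_assoc
  pushout.inl_desc pushout.inr_desc pushout.inl_desc_assoc pushout.inr_desc_assoc

/-! ### Extremal and regular epimorphisms -/

section Regular

variable {C : Type u} [Category.{v} C]

/-- Extremal epimorphisms are regular in a regular category; this form fits the joint extremality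
lemmas, which produce factorisations through a monomorphism. -/
theorem isRegularEpi_of_fac [Regular C] {X Y : C} (f : X ⟶ Y)
    (h : ∀ ⦃M : C⦄ (q : X ⟶ M) (m : M ⟶ Y) [Mono m], q ≫ m = f → ∃ j : Y ⟶ M, j ≫ m = 𝟙 Y) :
    IsRegularEpi f := by
  have : ExtremalEpi f := ExtremalEpi.mk_of_hasEqualizers f fun M q m hq _ => by
    obtain ⟨j, hj⟩ := h q m hq
    exact ⟨j, by rw [← cancel_mono m]; simp [hj], hj⟩
  infer_instance

theorem exists_fac_of_isRegularEpi {X Y M P : C} (e : X ⟶ Y) [IsRegularEpi e] (m : M ⟶ P) [Mono m]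
    (f : Y ⟶ P) (q : X ⟶ M) (w : q ≫ m = e ≫ f) : ∃ j : Y ⟶ M, j ≫ m = f := by
  have sq : CommSq q e m f := ⟨w⟩
  exact ⟨sq.lift, sq.fac_right⟩

end Regular

/-! ### Jointly extremal pairs, cokernels and kernels in homological categories -/

section Protomodular

variable {C : Type u} [Category.{v} C] [HasZeroMorphisms C]

/-- In a protomodular category, the section and the kernel of a point `(p, s)` on `X` are jointly
extremal: a morphism out of `X` factors through a monomorphism as soon as its restrictions to
these do. -/
theorem exists_fac_of_point [HasFiniteLimits C] [Protomodular C] {X G M P : C} {p : X ⟶ G}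
    {s : G ⟶ X} (hs : s ≫ p = 𝟙 G) (m : M ⟶ P) [Mono m] (f : X ⟶ P)
    (hG : ∃ a : G ⟶ M, a ≫ m = s ≫ f) (hK : ∃ b : kernel p ⟶ M, b ≫ m = kernel.ι p ≫ f) :
    ∃ j : X ⟶ M, j ≫ m = f := by
  obtain ⟨a, ha⟩ := hG
  obtain ⟨b, hb⟩ := hK
  -- The pullback of `m` along `f` contains both the section and the kernel, so the Split Short Five
  -- Lemma makes `n` invertible.
  let n : pullback m f ⟶ X := pullback.snd m f
  let k : kernel p ⟶ pullback m f := pullback.lift b (kernel.ι p) hb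
  have hk : k ≫ n = kernel.ι p := pullback.lift_snd _ _ _
  let s' : G ⟶ pullback m f := pullback.lift a s ha
  have hs' : s' ≫ n = s := pullback.lift_snd _ _ _
  have : IsIso (kernel.map (n ≫ p) p n (𝟙 G) (by simp)) := by
    refine ⟨kernel.lift (n ≫ p) k (by rw [reassoc_of% hk, kernel.condition]), ?_, ?_⟩
    · rw [← cancel_mono (kernel.ι _), ← cancel_mono n]
      simp [hk]
    · rw [← cancel_mono (kernel.ι p)]
      simp [hk]
  have : IsIso n := Protomodular.split_short_five (n ≫ p) s' p s (by simp [reassoc_of% hs', hs]) hs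
    n (𝟙 G) (by simp) (by simp [hs']) inferInstance this
  exact ⟨inv n ≫ pullback.fst m f, by simp [n, pullback.condition]⟩

/-- The section and the kernel of a point are jointly epimorphic. -/
theorem hom_ext_of_point [HasFiniteLimits C] [Protomodular C] {X G Y : C} {p : X ⟶ G}
    {s : G ⟶ X} (hs : s ≫ p = 𝟙 G) {f g : X ⟶ Y} (hG : s ≫ f = s ≫ g)
    (hK : kernel.ι p ≫ f = kernel.ι p ≫ g) : f = g := by
  obtain ⟨j, hj⟩ := exists_fac_of_point hs (equalizer.ι f g) (𝟙 X)
    ⟨equalizer.lift s hG, by simp⟩ ⟨equalizer.lift _ hK, by simp⟩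
  rw [← Category.id_comp f, ← Category.id_comp g, ← hj, Category.assoc, Category.assoc,
    equalizer.condition]

theorem kernel_ι_prod_snd [HasFiniteLimits C] (K L : C) :
    kernel.ι (prod.snd : K ⨯ L ⟶ L) =
      (kernel.ι (prod.snd : K ⨯ L ⟶ L) ≫ prod.fst) ≫ prod.lift (𝟙 K) 0 := by
  ext <;> simp

/-- The canonical injections into a binary product are jointly extremal. -/
theorem exists_fac_of_prod [HasFiniteLimits C] [Protomodular C] {K L M P : C} (m : M ⟶ P) [Mono m]
    (f : K ⨯ L ⟶ P) (hK : ∃ a : K ⟶ M, a ≫ m = prod.lift (𝟙 K) 0 ≫ f)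
    (hL : ∃ b : L ⟶ M, b ≫ m = prod.lift 0 (𝟙 L) ≫ f) : ∃ j : K ⨯ L ⟶ M, j ≫ m = f := by
  obtain ⟨a, ha⟩ := hK
  refine exists_fac_of_point (p := prod.snd) (s := prod.lift 0 (𝟙 L)) (by simp) m f hL
    ⟨(kernel.ι prod.snd ≫ prod.fst) ≫ a, ?_⟩
  conv_rhs => rw [kernel_ι_prod_snd]
  simp only [Category.assoc, ha]

/-- The canonical injections into a binary product are jointly epimorphic. -/
theorem prod_hom_ext [HasFiniteLimits C] [Protomodular C] {K L Y : C} {f g : K ⨯ L ⟶ Y}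
    (hK : prod.lift (𝟙 K) 0 ≫ f = prod.lift (𝟙 K) 0 ≫ g)
    (hL : prod.lift 0 (𝟙 L) ≫ f = prod.lift 0 (𝟙 L) ≫ g) : f = g := by
  refine hom_ext_of_point (p := prod.snd) (s := prod.lift 0 (𝟙 L)) (by simp) hL ?_
  rw [kernel_ι_prod_snd]
  simp only [Category.assoc, hK]

variable [Regular C]

variable [Protomodular C]

/-- In a homological category, a regular epimorphism is a cokernel of its kernel. -/
theorem exists_desc_of_kernel_ι_comp {X Y Z : C} (e : X ⟶ Y) [IsRegularEpi e] (f : X ⟶ Z)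
    (hf : kernel.ι e ≫ f = 0) : ∃ g : Y ⟶ Z, e ≫ g = f := by
  -- The first projection of the kernel pair is split by the diagonal, and the second projection
  -- carries its kernel into that of `e`, where `f` vanishes.
  have key : pullback.fst e e ≫ f = pullback.snd e e ≫ f := by
    refine hom_ext_of_point (p := pullback.fst e e) (s := pullback.lift (𝟙 X) (𝟙 X) rfl)
      (by simp) (by simp) ?_
    have : kernel.ι (pullback.fst e e) ≫ pullback.snd e e =
        kernel.lift e (kernel.ι (pullback.fst e e) ≫ pullback.snd e e)
          (by simp [← pullback.condition]) ≫ kernel.ι e := by simp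
    rw [← Category.assoc (g := pullback.snd e e), this, Category.assoc, hf]
    simp
  refine ⟨IsRegularEpi.desc e f ?_, IsRegularEpi.fac e f _⟩
  have := pullback.lift (IsRegularEpi.left e) (IsRegularEpi.right e) (IsRegularEpi.w e) ≫= key
  simpa using this

instance isRegularEpi_coprod_to_prod [HasFiniteColimits C] (K L : C) :
    IsRegularEpi (coprod.desc (prod.lift (𝟙 K) 0) (prod.lift 0 (𝟙 L)) : K ⨿ L ⟶ K ⨯ L) := by
  refine isRegularEpi_of_fac _ fun M q m _ hq => exists_fac_of_prod m _
    ⟨coprod.inl ≫ q, by simp [hq]⟩ ⟨coprod.inr ≫ q, by simp [hq]⟩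

instance isRegularEpi_prod_map {K L K' L' : C} (n : K ⟶ K') (m : L ⟶ L') [IsRegularEpi n]
    [IsRegularEpi m] : IsRegularEpi (prod.map n m) := by
  refine isRegularEpi_of_fac _ fun M q i _ hq => exists_fac_of_prod i _
    (exists_fac_of_isRegularEpi n i _ (prod.lift (𝟙 K) 0 ≫ q) ?_)
    (exists_fac_of_isRegularEpi m i _ (prod.lift 0 (𝟙 L) ≫ q) ?_)
  · rw [Category.assoc, hq]; ext <;> simp
  · rw [Category.assoc, hq]; ext <;> simp

/-- A regular epimorphism over a fixed object induces a regular epimorphism between kernels. -/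
instance isRegularEpi_kernel_map {X Y Z : C} (q : X ⟶ Y) (f : X ⟶ Z) (g : Y ⟶ Z)
    [IsRegularEpi q] (w : f ≫ 𝟙 Z = q ≫ g) : IsRegularEpi (kernel.map f g q (𝟙 Z) w) := by
  -- The map between kernels is a base change of `q`.
  have h : IsPullback (kernel.ι f) (kernel.map f g q (𝟙 Z) w) q (kernel.ι g) := by
    refine ⟨⟨by simp⟩, ⟨PullbackCone.IsLimit.mk _
      (fun t => kernel.lift f t.fst ?_) (fun t => by simp) (fun t => ?_) fun t r hr _ => ?_⟩⟩
    · rw [← Category.comp_id f, w, reassoc_of% t.condition]; simp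
    · rw [← cancel_mono (kernel.ι g)]; simp [t.condition]
    · rw [← cancel_mono (kernel.ι f)]; simp [hr]
  exact Regular.regularEpiIsStableUnderBaseChange.of_isPullback h ‹IsRegularEpi q›

end Protomodular

/-! ### Stability of Huq-commutation -/

section HuqCommute

variable {C : Type u} [Category.{v} C] [HasZeroMorphisms C]

theorem HuqCommute.precomp [HasFiniteLimits C] {K L K' L' X : C} {k : K ⟶ X} {l : L ⟶ X}
    (h : HuqCommute k l) (x : K' ⟶ K) (y : L' ⟶ L) : HuqCommute (x ≫ k) (y ≫ l) := by
  obtain ⟨φ, rfl, rfl⟩ := h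
  refine ⟨prod.map x y ≫ φ, ?_, ?_⟩
  · simp only [← Category.assoc]; congr 1; ext <;> simp
  · simp only [← Category.assoc]; congr 1; ext <;> simp

/-- Huq-commutation descends along regular epimorphisms. -/
theorem HuqCommute.of_precomp [Regular C] [Protomodular C] {K L K' L' X : C} {k : K' ⟶ X}
    {l : L' ⟶ X} (n : K ⟶ K') (m : L ⟶ L') [IsRegularEpi n] [IsRegularEpi m]
    (h : HuqCommute (n ≫ k) (m ≫ l)) : HuqCommute k l := by
  obtain ⟨φ, h₁, h₂⟩ := h
  -- The kernel of `n × m` is `Ker n × Ker m`, so it suffices that `φ` vanishes on each factor.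
  have hz : prod.map (kernel.ι n) (kernel.ι m) ≫ φ = 0 := by
    apply prod_hom_ext
    · have : prod.lift (𝟙 _) 0 ≫ prod.map (kernel.ι n) (kernel.ι m) =
        kernel.ι n ≫ prod.lift (𝟙 _) 0 := by ext <;> simp
      rw [reassoc_of% this, h₁]; simp
    · have : prod.lift 0 (𝟙 _) ≫ prod.map (kernel.ι n) (kernel.ι m) =
        kernel.ι m ≫ prod.lift 0 (𝟙 _) := by ext <;> simp
      rw [reassoc_of% this, h₂]; simp
  obtain ⟨ψ, hψ⟩ := exists_desc_of_kernel_ι_comp (prod.map n m) φ (by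
    have : kernel.ι (prod.map n m) = prod.lift
        (kernel.lift n (kernel.ι (prod.map n m) ≫ prod.fst)
          (by rw [Category.assoc, ← prod.map_fst n m, kernel.condition_assoc, zero_comp]))
        (kernel.lift m (kernel.ι (prod.map n m) ≫ prod.snd)
          (by rw [Category.assoc, ← prod.map_snd n m, kernel.condition_assoc, zero_comp])) ≫
        prod.map (kernel.ι n) (kernel.ι m) := by ext <;> simp
    rw [this, Category.assoc, hz, comp_zero])
  refine ⟨ψ, ?_, ?_⟩
  · rw [← cancel_epi n, ← h₁, ← hψ, ← Category.assoc, ← Category.assoc]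
    congr 1; ext <;> simp
  · rw [← cancel_epi m, ← h₂, ← hψ, ← Category.assoc, ← Category.assoc]
    congr 1; ext <;> simp

end HuqCommute

/-! ### Ideals and connectors in terms of generalized elements -/

section Relations

variable {C : Type u} [Category.{v} C] [HasZeroMorphisms C] [HasFiniteLimits C]

/-- An ideal is the normalisation of an equivalence relation, in terms of generalized elements. -/
theorem IsIdeal.exists_lift {K X : C} {k : K ⟶ X} (hk : IsIdeal k) :
    ∃ (R : C) (r₁ r₂ : R ⟶ X) (_ : EquivalenceRelation r₁ r₂) (κ : K ⟶ R),
      κ ≫ r₁ = 0 ∧ κ ≫ r₂ = k ∧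
      ∀ ⦃T : C⦄ (t : T ⟶ R), t ≫ r₁ = 0 → ∃ t' : T ⟶ K, t' ≫ k = t ≫ r₂ := by
  obtain ⟨R, r₁, r₂, e, i, hi⟩ := hk
  refine ⟨R, r₁, r₂, e, i.hom ≫ kernel.ι r₁, by simp, by simpa [normalisation] using hi,
    fun T t ht => ⟨kernel.lift r₁ t ht ≫ i.inv, ?_⟩⟩
  rw [← hi]
  simp [normalisation]

/-- The Smith is Huq condition yields connectors between kernel pairs whose kernels commute. -/
theorem SmithIsHuq.exists_connector (h : SmithIsHuq C) {Q A B : C} (a : Q ⟶ A) (c : Q ⟶ B)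
    (hac : HuqCommute (kernel.ι c) (kernel.ι a)) :
    ∃ θ : pullback (pullback.fst c c) (pullback.snd a a) ⟶ Q,
      (∀ ⦃T : C⦄ (t : T ⟶ pullback (pullback.fst c c) (pullback.snd a a)),
        t ≫ pullback.snd _ _ ≫ pullback.fst a a = t ≫ pullback.snd _ _ ≫ pullback.snd a a →
        t ≫ θ = t ≫ pullback.fst _ _ ≫ pullback.snd c c) ∧
      (∀ ⦃T : C⦄ (t : T ⟶ pullback (pullback.fst c c) (pullback.snd a a)),
        t ≫ pullback.fst _ _ ≫ pullback.fst c c = t ≫ pullback.fst _ _ ≫ pullback.snd c c →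
        t ≫ θ = t ≫ pullback.snd _ _ ≫ pullback.fst a a) := by
  have kc : IsKernelPair c (pullback.fst c c) (pullback.snd c c) := .of_hasPullback c
  have ka : IsKernelPair a (pullback.fst a a) (pullback.snd a a) := .of_hasPullback a
  let ec := kc.equivalenceRelation _ _ _ (pullbackIsPullback _ _)
  let ea := ka.equivalenceRelation _ _ _ (pullbackIsPullback _ _)
  have hk {B' : C} (f : Q ⟶ B') : normalisation (pullback.fst f f) (pullback.snd f f) =
      kernel.lift f (normalisation (pullback.fst f f) (pullback.snd f f))
        (by simp [normalisation, ← pullback.condition]) ≫ kernel.ι f := by simp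
  obtain ⟨θ, h₁, h₂⟩ := h ec ea ⟨_, c, kc⟩ ⟨_, a, ka⟩ (by
    rw [hk c, hk a]; exact hac.precomp _ _)
  refine ⟨θ, fun T t ht => ?_, fun T t ht => ?_⟩
  · rw [← h₁, ← Category.assoc, ← Category.assoc]
    congr 1
    ext <;> simp [ea.reflexivity₁, ea.reflexivity₂]
    all_goals simp [ht, pullback.condition]
  · rw [← h₂, ← Category.assoc, ← Category.assoc]
    congr 1
    ext <;> simp [ec.reflexivity₁, ec.reflexivity₂]
    all_goals simp [← ht, pullback.condition]

end Relations

/-! ### From Smith is Huq to the commutator inequality -/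

section Commutators

variable {C : Type u} [Category.{v} C] [HasZeroMorphisms C]

/-- The morphism `K + L + X ⟶ K + X` which sends `L` to zero. -/
noncomputable abbrev coprodProjLeft [HasFiniteColimits C] (K L X : C) : (K ⨿ L) ⨿ X ⟶ K ⨿ X :=
  coprod.desc (coprod.desc coprod.inl 0) coprod.inr

/-- The morphism `K + L + X ⟶ L + X` which sends `K` to zero. -/
noncomputable abbrev coprodProjRight [HasFiniteColimits C] (K L X : C) : (K ⨿ L) ⨿ X ⟶ L ⨿ X :=
  coprod.desc (coprod.desc 0 coprod.inl) coprod.inr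

/-- The morphism `K + X ⟶ X` which sends `K` to zero. -/
noncomputable abbrev coprodProj [HasFiniteColimits C] (K X : C) : K ⨿ X ⟶ X :=
  coprod.desc 0 (𝟙 X)

/-- The inclusion `K + X ⟶ K + L + X`. -/
noncomputable abbrev coprodInclLeft [HasFiniteColimits C] (K L X : C) : K ⨿ X ⟶ (K ⨿ L) ⨿ X :=
  coprod.desc (coprod.inl ≫ coprod.inl) coprod.inr

/-- The inclusion `L + X ⟶ K + L + X`. -/
noncomputable abbrev coprodInclRight [HasFiniteColimits C] (K L X : C) : L ⨿ X ⟶ (K ⨿ L) ⨿ X :=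
  coprod.desc (coprod.inr ≫ coprod.inl) coprod.inr

/-- The comparison `K + L + X ⟶ (K + X) ×_X (L + X)`. -/
noncomputable abbrev coprodToPullback [HasFiniteLimits C] [HasFiniteColimits C] (K L X : C) :
    (K ⨿ L) ⨿ X ⟶ pullback (coprodProj K X) (coprodProj L X) :=
  pullback.lift (coprodProjLeft K L X) (coprodProjRight K L X) (by ext <;> simp)

variable [HasFiniteColimits C]

/-- Under the Smith is Huq condition, a morphism on `K + L + X` under which the kernels of the
projections to `L + X` and `K + X` commute vanishes on the intersection of these kernels. -/
theorem SmithIsHuq.comp_eq_zero [Regular C] [Protomodular C] (h : SmithIsHuq C) {K L X Y T : C}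
    (u : (K ⨿ L) ⨿ X ⟶ Y)
    (hu : HuqCommute (kernel.ι (coprodProjRight K L X) ≫ u) (kernel.ι (coprodProjLeft K L X) ≫ u))
    (z : T ⟶ (K ⨿ L) ⨿ X) (hz₁ : z ≫ coprodProjLeft K L X = 0)
    (hz₂ : z ≫ coprodProjRight K L X = 0) : z ≫ u = 0 := by
  obtain ⟨ψ, hψ₁, hψ₂⟩ := hu
  let a := coprodProjLeft K L X
  let c := coprodProjRight K L X
  let j : kernel c ⨿ kernel a ⟶ kernel c ⨯ kernel a :=
    coprod.desc (prod.lift (𝟙 _) 0) (prod.lift 0 (𝟙 _))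
  let d := coprod.desc (kernel.ι c) (kernel.ι a)
  -- Universal quotient making `Ker c` and `Ker a` commute. The maps `a`, `c` and `u` all factor
  -- through it.
  let q : (K ⨿ L) ⨿ X ⟶ pushout d j := pushout.inl d j
  have : IsRegularEpi q := isRegularEpi_of_regularEpi
    (regularOfIsPushoutSndOfRegular (IsRegularEpi.getStruct j) pushout.condition
      (pushoutIsPushout d j))
  let c₀ : pushout d j ⟶ L ⨿ X := pushout.desc c (prod.snd ≫ kernel.ι a ≫ c)
    (by ext <;> simp [d, j])
  let a₀ : pushout d j ⟶ K ⨿ X := pushout.desc a (prod.fst ≫ kernel.ι c ≫ a)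
    (by ext <;> simp [d, j])
  let u₀ : pushout d j ⟶ Y := pushout.desc u ψ (by ext <;> simp [d, j, hψ₁, hψ₂, a, c])
  have hqc : q ≫ c₀ = c := pushout.inl_desc _ _ _
  have hqa : q ≫ a₀ = a := pushout.inl_desc _ _ _
  have hqu : q ≫ u₀ = u := pushout.inl_desc _ _ _
  -- `Ker c` and `Ker a` cover `Ker c₀` and `Ker a₀`, so commutation passes to the latter.
  obtain ⟨θ, hθ₁, hθ₂⟩ := h.exists_connector a₀ c₀ (by
    refine HuqCommute.of_precomp (kernel.map c c₀ q (𝟙 _) (by simp [hqc]))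
      (kernel.map a a₀ q (𝟙 _) (by simp [hqa])) ⟨pushout.inr d j, ?_, ?_⟩
    · simpa [d, j] using (coprod.inl ≫= pushout.condition (f := d) (g := j)).symm
    · simpa [d, j] using (coprod.inr ≫= pushout.condition (f := d) (g := j)).symm)
  -- A pair `(x, y)` over `t` goes to `((q t, q x), (q y, q t))`, which `θ` should send to "`q x - q
  -- t + q y`".
  let e : pullback (coprodProj K X) (coprodProj L X) ⟶
      pullback (pullback.fst c₀ c₀) (pullback.snd a₀ a₀) :=
    pullback.lift
      (pullback.lift (pullback.fst _ _ ≫ coprodProj K X ≫ coprod.inr ≫ q)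
        (pullback.fst _ _ ≫ coprodInclLeft K L X ≫ q)
        (by simp only [Category.assoc, hqc]; congr 1; ext <;> simp [c]))
      (pullback.lift (pullback.snd _ _ ≫ coprodInclRight K L X ≫ q)
        (pullback.snd _ _ ≫ coprodProj L X ≫ coprod.inr ≫ q)
        (by simp only [Category.assoc, hqa]; congr 1; ext <;> simp [a]))
      (by simp only [pullback.lift_fst, pullback.lift_snd, pullback.condition_assoc])
  -- On `K` and on `X` one has `y = t`, on `L` one has `x = t`, so a connector identity computes `θ`
  -- on each summand.
  have hq : coprodToPullback K L X ≫ e ≫ θ = q := by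
    ext
    · have := hθ₁ (coprod.inl ≫ coprod.inl ≫ coprodToPullback K L X ≫ e) (by simp [e])
      simpa [e] using this
    · have := hθ₂ (coprod.inr ≫ coprod.inl ≫ coprodToPullback K L X ≫ e) (by simp [e])
      simpa [e] using this
    · have := hθ₁ (coprod.inr ≫ coprodToPullback K L X ≫ e) (by simp [e])
      simpa [e] using this
  have hz : z ≫ coprodToPullback K L X = 0 := by ext <;> simp [hz₁, hz₂]
  rw [← hqu, ← hq, Category.assoc, reassoc_of% hz, zero_comp]

/-- Under the Smith is Huq condition, `[K, L, X] ≤ [K, L]` for ideals `K`, `L` of `X`. -/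
theorem SmithIsHuq.ternaryCommutator_le [Regular C] [Protomodular C] (h : SmithIsHuq C)
    {X K L : C} {k : K ⟶ X} {l : L ⟶ X} (hk : IsIdeal k) (hl : IsIdeal l) :
    ternaryCommutator k l (𝟙 X) ≤ huqCommutator k l := by
  obtain ⟨R, r₁, r₂, eR, κ, hκ₁, hκ₂, hκ⟩ := hk.exists_lift
  obtain ⟨S, s₁, s₂, eS, l', hl₁, hl₂, hl⟩ := hl.exists_lift
  let u : (K ⨿ L) ⨿ X ⟶ X := coprod.desc (coprod.desc k l) (𝟙 X)
  -- `uR` relates the value of `u` with `K` set to zero to `u` itself, so `u` maps the kernel of the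
  -- projection to `L + X` into the ideal `K`; `uS` does the same for `L`.
  let uR : (K ⨿ L) ⨿ X ⟶ R := coprod.desc (coprod.desc κ (l ≫ eR.r)) eR.r
  let uS : (K ⨿ L) ⨿ X ⟶ S := coprod.desc (coprod.desc (k ≫ eS.r) l') eS.r
  have hR₁ : uR ≫ r₁ = coprodProjRight K L X ≫ coprod.desc l (𝟙 X) := by
    ext <;> simp [uR, hκ₁]
  have hR₂ : uR ≫ r₂ = u := by ext <;> simp [uR, u, hκ₂]
  have hS₁ : uS ≫ s₁ = coprodProjLeft K L X ≫ coprod.desc k (𝟙 X) := by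
    ext <;> simp [uS, hl₁]
  have hS₂ : uS ≫ s₂ = u := by ext <;> simp [uS, u, hl₂]
  obtain ⟨n, hn⟩ := hκ (kernel.ι (coprodProjRight K L X) ≫ uR)
    (by rw [Category.assoc, hR₁, kernel.condition_assoc, zero_comp])
  obtain ⟨m, hm⟩ := hl (kernel.ι (coprodProjLeft K L X) ≫ uS)
    (by rw [Category.assoc, hS₁, kernel.condition_assoc, zero_comp])
  rw [Category.assoc, hR₂] at hn
  rw [Category.assoc, hS₂] at hm
  let d := coprod.desc k l
  let j : K ⨿ L ⟶ K ⨯ L := coprod.desc (prod.lift (𝟙 K) 0) (prod.lift 0 (𝟙 L))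
  have hcomm : HuqCommute (k ≫ pushout.inl d j) (l ≫ pushout.inl d j) :=
    ⟨pushout.inr d j,
      by simpa [d, j] using (coprod.inl ≫= pushout.condition (f := d) (g := j)).symm,
      by simpa [d, j] using (coprod.inr ≫= pushout.condition (f := d) (g := j)).symm⟩
  have hzero : coSmashι K L X ≫ coSmashComparison K L X = 0 := kernel.condition _
  have hι : (coSmashι K L X ≫ u) ≫ pushout.inl d j = 0 := by
    rw [Category.assoc]
    refine h.comp_eq_zero (u ≫ pushout.inl d j) ?_ _ ?_ ?_
    · rw [← reassoc_of% hn, ← reassoc_of% hm]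
      exact hcomm.precomp n m
    · simpa [coSmashComparison] using (hzero =≫ prod.snd) =≫ prod.fst
    · simpa [coSmashComparison] using (hzero =≫ prod.snd) =≫ prod.snd
  exact imageSubobject_le _ (factorThruKernelSubobject _ _ hι)
    (factorThruKernelSubobject_comp_arrow _ _ hι)

end Commutators

/-! ### From the commutator inequality to connectors -/

section Connectors

variable {C : Type u} [Category.{v} C] [HasZeroMorphisms C] [HasFiniteColimits C]

/-- When `k` and `l` commute, `φ` induces a retraction of the map from `X` to the pushout, so its
kernel is zero. -/
theorem HuqCommute.comp_eq_zero_of_factors [HasFiniteLimits C] {K L X T : C} {k : K ⟶ X} {l : L ⟶ X}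
    (h : HuqCommute k l) (t : T ⟶ X) (ht : (huqCommutator k l).Factors t) : t = 0 := by
  obtain ⟨φ, h₁, h₂⟩ := h
  let d := coprod.desc k l
  let j : K ⨿ L ⟶ K ⨯ L := coprod.desc (prod.lift (𝟙 K) 0) (prod.lift 0 (𝟙 L))
  have hr : pushout.inl d j ≫ pushout.desc (𝟙 X) φ (by ext <;> simp [d, j, h₁, h₂]) = 𝟙 X :=
    pushout.inl_desc _ _ _
  rw [← Category.comp_id t, ← hr, ← Category.assoc]
  have : t ≫ pushout.inl d j = 0 := by
    rw [← Subobject.factorThru_arrow _ t ht, Category.assoc]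
    exact (congrArg _ (kernelSubobject_arrow_comp _)).trans comp_zero
  rw [this, zero_comp]

theorem kernel_ι_pullback_snd [HasFiniteLimits C] (K L X : C) :
    kernel.ι (pullback.snd (coprodProj K X) (coprodProj L X)) =
      (kernel.ι (pullback.snd (coprodProj K X) (coprodProj L X)) ≫ pullback.fst _ _) ≫
        coprodInclLeft K L X ≫ coprodToPullback K L X := by
  have h₁ : coprodInclLeft K L X ≫ coprodProjLeft K L X = 𝟙 _ := by ext <;> simp
  have h₂ : coprodInclLeft K L X ≫ coprodProjRight K L X = coprodProj K X ≫ coprod.inr := by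
    ext <;> simp
  ext
  · simp only [Category.assoc, pullback.lift_fst, h₁, Category.comp_id]
  · simp only [Category.assoc, pullback.lift_snd, h₂, pullback.condition_assoc,
      kernel.condition, kernel.condition_assoc, zero_comp]

variable [Regular C] [Protomodular C]

/-- The comparison `K + L + X ⟶ (K + X) ×_X (L + X)` is a regular epimorphism. -/
instance isRegularEpi_coprodToPullback (K L X : C) : IsRegularEpi (coprodToPullback K L X) := by
  refine isRegularEpi_of_fac _ fun M q m _ hq => ?_
  refine exists_fac_of_point (p := pullback.snd _ _)
    (s := coprodInclRight K L X ≫ coprodToPullback K L X) ?_ m _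
    ⟨coprodInclRight K L X ≫ q, by simp [hq]⟩
    ⟨(kernel.ι _ ≫ pullback.fst _ _) ≫ coprodInclLeft K L X ≫ q, ?_⟩
  · rw [Category.assoc, pullback.lift_snd]; ext <;> simp
  · conv_rhs => rw [kernel_ι_pullback_snd]
    simp only [Category.assoc, hq, Category.comp_id]

/-- A morphism on `K + L + X` which vanishes on the co-smash product and whose restrictions to `K`
and `L` commute vanishes on the kernel of `K + L + X ⟶ (K + X) ×_X (L + X)`. -/
theorem kernel_ι_coprodToPullback_comp {K L X Y : C} (u : (K ⨿ L) ⨿ X ⟶ Y)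
    (hu : coSmashι K L X ≫ u = 0)
    (hc : HuqCommute (coprod.inl ≫ coprod.inl ≫ u) (coprod.inr ≫ coprod.inl ≫ u)) :
    kernel.ι (coprodToPullback K L X) ≫ u = 0 := by
  let W := kernel (coprodToPullback K L X)
  let w : W ⟶ (K ⨿ L) ⨿ X := kernel.ι _
  have hw₁ : w ≫ coprodProjLeft K L X = 0 := by
    have : coprodToPullback K L X ≫ pullback.fst _ _ = coprodProjLeft K L X :=
      pullback.lift_fst _ _ _
    rw [← this, kernel.condition_assoc, zero_comp]
  have hw₂ : w ≫ coprodProjRight K L X = 0 := by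
    have : coprodToPullback K L X ≫ pullback.snd _ _ = coprodProjRight K L X :=
      pullback.lift_snd _ _ _
    rw [← this, kernel.condition_assoc, zero_comp]
  let j : K ⨿ L ⟶ K ⨯ L := coprod.desc (prod.lift (𝟙 K) 0) (prod.lift 0 (𝟙 L))
  let d : (K ⨿ L) ⨿ X ⟶ K ⨿ L := coprod.desc (coprod.desc coprod.inl coprod.inr) 0
  have hd₁ : d ≫ j ≫ prod.fst = coprodProjLeft K L X ≫ coprod.desc (𝟙 K) 0 := by
    ext <;> simp [d, j]
  have hd₂ : d ≫ j ≫ prod.snd = coprodProjRight K L X ≫ coprod.desc (𝟙 L) 0 := by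
    ext <;> simp [d, j]
  have hι₁ : (coprod.inl : K ⨿ L ⟶ (K ⨿ L) ⨿ X) ≫ coprodProjLeft K L X =
      j ≫ prod.fst ≫ coprod.inl := by ext <;> simp [j]
  have hι₂ : (coprod.inl : K ⨿ L ⟶ (K ⨿ L) ⨿ X) ≫ coprodProjRight K L X =
      j ≫ prod.snd ≫ coprod.inl := by ext <;> simp [j]
  -- `W` is split over the kernel of `K + L ⟶ K × L`. On the section, `u` vanishes since `K` and `L`
  -- commute; the kernel of `p` is also killed by `d`, the missing component of `coSmashComparison`,
  -- so it lies in the co-smash product.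
  let p : W ⟶ kernel j := kernel.lift j (w ≫ d) (by
    ext
    · simp only [Category.assoc, hd₁, reassoc_of% hw₁, zero_comp]
    · simp only [Category.assoc, hd₂, reassoc_of% hw₂, zero_comp])
  let s : kernel j ⟶ W := kernel.lift _ (kernel.ι j ≫ coprod.inl) (by
    ext
    · simp only [Category.assoc, pullback.lift_fst, hι₁, kernel.condition_assoc, zero_comp]
    · simp only [Category.assoc, pullback.lift_snd, hι₂, kernel.condition_assoc, zero_comp])
  have hs : s ≫ w = kernel.ι j ≫ coprod.inl := kernel.lift_ι _ _ _
  have hp : p ≫ kernel.ι j = w ≫ d := kernel.lift_ι _ _ _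
  have hsp : s ≫ p = 𝟙 _ := by
    rw [← cancel_mono (kernel.ι j), Category.assoc, hp, reassoc_of% hs]
    have : (coprod.inl : K ⨿ L ⟶ (K ⨿ L) ⨿ X) ≫ d = 𝟙 _ := by ext <;> simp [d]
    rw [this, Category.comp_id, Category.id_comp]
  refine hom_ext_of_point hsp ?_ ?_
  · obtain ⟨φ, h₁, h₂⟩ := hc
    have : coprod.inl ≫ u = j ≫ φ := by ext <;> simp [j, h₁, h₂]
    rw [reassoc_of% hs, this, kernel.condition_assoc, zero_comp, comp_zero]
  · have hz : (kernel.ι p ≫ w) ≫ coSmashComparison K L X = 0 := by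
      have : (kernel.ι p ≫ w) ≫ d = 0 := by
        rw [Category.assoc, ← hp, kernel.condition_assoc, zero_comp]
      dsimp only [coSmashComparison]
      ext
      · simpa [d] using this
      · simp [hw₁]
      · simp [hw₂]
    let v : kernel p ⟶ coSmash K L X := kernel.lift _ _ hz
    have : v ≫ coSmashι K L X = kernel.ι p ≫ w := kernel.lift_ι _ _ _
    rw [comp_zero, ← reassoc_of% this, hu, comp_zero]

/-- If the normalisations `K` and `L` of two equivalence relations on `X` commute and the ternary
commutator `[K, L, X]` vanishes, then the equivalence relations commute. -/
theorem smithCommute_of_coSmashι_comp {X R S : C} {r₁ r₂ : R ⟶ X} {s₁ s₂ : S ⟶ X}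
    (eR : EquivalenceRelation r₁ r₂) (eS : EquivalenceRelation s₁ s₂)
    (hc : HuqCommute (normalisation r₁ r₂) (normalisation s₁ s₂))
    (h : coSmashι (kernel r₁) (kernel s₁) X ≫
      coprod.desc (coprod.desc (normalisation r₁ r₂) (normalisation s₁ s₂)) (𝟙 X) = 0) :
    SmithCommute eR eS := by
  let K := kernel r₁
  let L := kernel s₁
  let κ : K ⟶ R := kernel.ι r₁
  -- The connector lives on the pullback of `r₁` and `s₂`; symmetry turns the kernel of `s₁` into
  -- that of `s₂`.
  let l : L ⟶ S := kernel.ι s₁ ≫ eS.s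
  have hκ₁ : κ ≫ r₁ = 0 := kernel.condition _
  have hl₁ : l ≫ s₁ = normalisation s₁ s₂ := by
    rw [Category.assoc, eS.symmetry₁, normalisation]
  have hl₂ : l ≫ s₂ = 0 := by rw [Category.assoc, eS.symmetry₂, kernel.condition]
  have hker : ∃ n : kernel s₂ ⟶ L, n ≫ l = kernel.ι s₂ := by
    refine ⟨kernel.lift s₁ (kernel.ι s₂ ≫ eS.s)
      (by rw [Category.assoc, eS.symmetry₁, kernel.condition]), ?_⟩
    refine eS.right_cancellation _ _ ?_ ?_ <;>
      simp [l, eS.symmetry₁, eS.symmetry₂]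
  let u : (K ⨿ L) ⨿ X ⟶ X :=
    coprod.desc (coprod.desc (normalisation r₁ r₂) (normalisation s₁ s₂)) (𝟙 X)
  obtain ⟨ψ, hψ⟩ := exists_desc_of_kernel_ι_comp (coprodToPullback K L X) u
    (kernel_ι_coprodToPullback_comp u h (by simpa [u] using hc))
  let fR : K ⨿ X ⟶ R := coprod.desc κ eR.r
  let fS : L ⨿ X ⟶ S := coprod.desc l eS.r
  have hfR : fR ≫ r₁ = coprodProj K X := by ext <;> simp [fR, hκ₁]
  have hfS : fS ≫ s₂ = coprodProj L X := by ext <;> simp [fS, hl₂]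
  let ρ : pullback (coprodProj K X) (coprodProj L X) ⟶ pullback r₁ s₂ :=
    pullback.lift (pullback.fst _ _ ≫ fR) (pullback.snd _ _ ≫ fS)
      (by simp only [Category.assoc, hfR, hfS, pullback.condition])
  let w : (K ⨿ L) ⨿ X ⟶ pullback (coprodProj K X) (coprodProj L X) := coprodToPullback K L X
  have hK : kernel.ι r₁ ≫ pullback.lift (𝟙 R) (r₁ ≫ eS.r) (by simp) =
      coprod.inl ≫ coprod.inl ≫ w ≫ ρ := by
    ext <;> simp [w, ρ, fR, fS, κ]
  have hL : l ≫ pullback.lift (s₂ ≫ eR.r) (𝟙 S) (by simp) =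
      coprod.inr ≫ coprod.inl ≫ w ≫ ρ := by
    ext <;> simp [w, ρ, fR, fS, reassoc_of% hl₂]
  have hXR : eR.r ≫ pullback.lift (𝟙 R) (r₁ ≫ eS.r) (by simp) = coprod.inr ≫ w ≫ ρ := by
    ext <;> simp [w, ρ, fR, fS]
  have hXS : eS.r ≫ pullback.lift (s₂ ≫ eR.r) (𝟙 S) (by simp) = coprod.inr ≫ w ≫ ρ := by
    ext <;> simp [w, ρ, fR, fS]
  -- `R ×_X S` is covered by `Ker r₁` and `S`, and `S` by `Ker s₂` and its diagonal; all these
  -- pieces lift along `w ≫ ρ`.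
  have : IsRegularEpi ρ := by
    refine isRegularEpi_of_fac _ fun M q m _ hq => ?_
    refine exists_fac_of_point (p := pullback.snd r₁ s₂)
      (s := pullback.lift (s₂ ≫ eR.r) (𝟙 S) (by simp)) (by simp) m _ ?_ ?_
    · rw [Category.comp_id]
      obtain ⟨n, hn⟩ := hker
      refine exists_fac_of_point eS.reflexivity₂ m _ ⟨coprod.inr ≫ w ≫ q, ?_⟩
        ⟨n ≫ coprod.inr ≫ coprod.inl ≫ w ≫ q, ?_⟩
      · rw [hXS, Category.assoc, Category.assoc, hq]
      · rw [← hn]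
        simp only [Category.assoc, hq, hL]
    · let κ' : kernel (pullback.snd r₁ s₂) ⟶ kernel r₁ :=
        kernel.lift r₁ (kernel.ι _ ≫ pullback.fst r₁ s₂) (by simp [pullback.condition])
      have hκ' : κ' ≫ kernel.ι r₁ = kernel.ι _ ≫ pullback.fst r₁ s₂ := kernel.lift_ι _ _ _
      have : kernel.ι (pullback.snd r₁ s₂) =
          κ' ≫ kernel.ι r₁ ≫ pullback.lift (𝟙 R) (r₁ ≫ eS.r) (by simp) := by
        ext
        · simp [hκ']
        · simp
      refine ⟨κ' ≫ coprod.inl ≫ coprod.inl ≫ w ≫ q, ?_⟩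
      rw [this]
      simp only [Category.assoc, hq, hK, Category.comp_id]
      rfl
  -- `Ker ρ` is `Ker fR × Ker fS`; on the factors `ψ` restricts to `fR ≫ r₂` and `fS ≫ s₁`, hence to
  -- zero.
  have hker_ρ : kernel.ι ρ ≫ ψ = 0 := by
    let ζ : kernel fR ⨯ kernel fS ⟶ pullback (coprodProj K X) (coprodProj L X) :=
      pullback.lift (prod.fst ≫ kernel.ι fR) (prod.snd ≫ kernel.ι fS)
        (by simp only [Category.assoc, ← hfR, ← hfS, kernel.condition_assoc, zero_comp, comp_zero])
    have hζ : ζ ≫ ψ = 0 := by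
      apply prod_hom_ext
      · have h₁ : prod.lift (𝟙 _) 0 ≫ ζ = kernel.ι fR ≫ coprodInclLeft K L X ≫ w := by
          have h₂ : coprodInclLeft K L X ≫ coprodProjLeft K L X = 𝟙 _ := by ext <;> simp
          have h₃ : coprodInclLeft K L X ≫ coprodProjRight K L X =
              fR ≫ r₁ ≫ coprod.inr := by rw [reassoc_of% hfR]; ext <;> simp
          ext
          · simp only [Category.assoc, ζ, w, pullback.lift_fst, prod.lift_fst_assoc, h₂,
              Category.id_comp, Category.comp_id]
          · simp only [Category.assoc, ζ, w, pullback.lift_snd, prod.lift_snd_assoc, h₃,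
              kernel.condition_assoc, zero_comp]
        have h₂ : coprodInclLeft K L X ≫ u = fR ≫ r₂ := by
          ext <;> simp [u, fR, normalisation, κ]
        rw [reassoc_of% h₁, hψ, h₂, kernel.condition_assoc, zero_comp, comp_zero]
      · have h₁ : prod.lift 0 (𝟙 _) ≫ ζ = kernel.ι fS ≫ coprodInclRight K L X ≫ w := by
          have h₂ : coprodInclRight K L X ≫ coprodProjRight K L X = 𝟙 _ := by ext <;> simp
          have h₃ : coprodInclRight K L X ≫ coprodProjLeft K L X =
              fS ≫ s₂ ≫ coprod.inr := by rw [reassoc_of% hfS]; ext <;> simp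
          ext
          · simp only [Category.assoc, ζ, w, pullback.lift_fst, prod.lift_fst_assoc, h₃,
              kernel.condition_assoc, zero_comp]
          · simp only [Category.assoc, ζ, w, pullback.lift_snd, prod.lift_snd_assoc, h₂,
              Category.id_comp, Category.comp_id]
        have h₂ : coprodInclRight K L X ≫ u = fS ≫ s₁ := by
          ext <;> simp [u, fS, hl₁]
        rw [reassoc_of% h₁, hψ, h₂, kernel.condition_assoc, zero_comp, comp_zero]
    have hfst : (kernel.ι ρ ≫ pullback.fst _ _) ≫ fR = 0 := by
      have : ρ ≫ pullback.fst _ _ = pullback.fst _ _ ≫ fR := pullback.lift_fst _ _ _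
      rw [Category.assoc, ← this, kernel.condition_assoc, zero_comp]
    have hsnd : (kernel.ι ρ ≫ pullback.snd _ _) ≫ fS = 0 := by
      have : ρ ≫ pullback.snd _ _ = pullback.snd _ _ ≫ fS := pullback.lift_snd _ _ _
      rw [Category.assoc, ← this, kernel.condition_assoc, zero_comp]
    have : kernel.ι ρ = prod.lift (kernel.lift fR _ hfst) (kernel.lift fS _ hsnd) ≫ ζ := by
      ext <;> simp [ζ]
    rw [this, Category.assoc, hζ, comp_zero]
  obtain ⟨θ, hθ⟩ := exists_desc_of_kernel_ι_comp ρ ψ hker_ρ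
  -- Each connector identity is tested on the diagonal and on the kernel of the relevant projection,
  -- where `θ` is computed by `u`.
  refine ⟨θ, hom_ext_of_point eR.reflexivity₁ ?_ ?_, hom_ext_of_point eS.reflexivity₂ ?_ ?_⟩
  · rw [reassoc_of% hXR, hθ, hψ, eR.reflexivity₂, coprod.inr_desc]
  · rw [reassoc_of% hK, hθ, hψ, coprod.inl_desc, coprod.inl_desc, normalisation]
  · rw [reassoc_of% hXS, hθ, hψ, eS.reflexivity₁, coprod.inr_desc]
  · obtain ⟨n, hn⟩ := hker
    rw [← hn, Category.assoc n l, Category.assoc n l, reassoc_of% hL, hθ, hψ, coprod.inl_desc,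
      coprod.inr_desc, hl₁]

/-- If `[K, L, X] ≤ [K, L]` for the normalisations `K`, `L` of two equivalence relations on `X`, then
these equivalence relations commute as soon as `K` and `L` do. -/
theorem smithCommute_of_ternaryCommutator_le {X R S : C} {r₁ r₂ : R ⟶ X} {s₁ s₂ : S ⟶ X}
    (eR : EquivalenceRelation r₁ r₂) (eS : EquivalenceRelation s₁ s₂)
    (hc : HuqCommute (normalisation r₁ r₂) (normalisation s₁ s₂))
    (h : ternaryCommutator (normalisation r₁ r₂) (normalisation s₁ s₂) (𝟙 X) ≤
      huqCommutator (normalisation r₁ r₂) (normalisation s₁ s₂)) :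
    SmithCommute eR eS :=
  smithCommute_of_coSmashι_comp eR eS hc <| hc.comp_eq_zero_of_factors _ <|
    Subobject.factors_of_le _ h ⟨factorThruImage _, by simp⟩

end Connectors

end SmithHuq

open SmithHuq in
theorem theorem4p6 (C : Type u) [Category.{v} C] [HasZeroObject C] [HasZeroMorphisms C]
    [Regular C] [Protomodular C] [HasFiniteColimits C] :
    List.TFAE [
      SmithIsHuq C,
      ∀ ⦃X R S : C⦄ ⦃r₁ r₂ : R ⟶ X⦄ ⦃s₁ s₂ : S ⟶ X⦄
        (eR : EquivalenceRelation r₁ r₂) (eS : EquivalenceRelation s₁ s₂),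
        IsEffective r₁ r₂ → IsEffective s₁ s₂ →
        HuqCommute (normalisation r₁ r₂) (normalisation s₁ s₂) → SmithCommute eR eS,
      ∀ ⦃X R S : C⦄ ⦃r₁ r₂ : R ⟶ X⦄ ⦃s₁ s₂ : S ⟶ X⦄
        (eR : EquivalenceRelation r₁ r₂) (eS : EquivalenceRelation s₁ s₂),
        HuqCommute (normalisation r₁ r₂) (normalisation s₁ s₂) → SmithCommute eR eS,
      ∀ ⦃X K L : C⦄ (k : K ⟶ X) (l : L ⟶ X), IsIdeal k → IsIdeal l →
        ternaryCommutator k l (𝟙 X) ≤ huqCommutator k l] := by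
  tfae_have 1 ↔ 2 := Iff.rfl
  tfae_have 3 → 2 := fun h _ _ _ _ _ _ _ eR eS _ _ hc => h eR eS hc
  tfae_have 1 → 4 := fun h _ _ _ _ _ hk hl => h.ternaryCommutator_le hk hl
  tfae_have 4 → 3 := fun h _ _ _ _ _ _ _ eR eS hc =>
    smithCommute_of_ternaryCommutator_le eR eS hc
      (h _ _ ⟨_, _, _, eR, Iso.refl _, Category.id_comp _⟩
        ⟨_, _, _, eS, Iso.refl _, Category.id_comp _⟩)
  tfae_finish
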